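/- \textbf{Dovbysh--Sudakov Theorem.} Let $R=(R_{ij})_{i,j\in\mathbb{N}}$ be a random real matrix which is almost surely positive semidefinite (that is, symmetric with $\sum_{i,j} c_i c_j R_{ij}\ge 0$ for every finitely supported real sequence $(c_i)$), and which is jointly exchangeable: for every permutation $\sigma$ of $\mathbb{N}$ fixing all but finitely many elements, $(R_{\sigma(i)\sigma(j)})_{i,j}$ has the same law as $(R_{ij})_{i,j}$. Then there are a separable real Hilbert space $\mathfrak{H}$ and, on some probability space, a sequence $(\xi_i,a_i)_{i\in\mathbb{N}}$ of random variables valued in $\mathfrak{H}\times[0,\infty)$ that is exchangeable (its law is invariant under every permutation of the indices fixing all but finitely many of them), such that \[(R_{ij})_{i,j\in\mathbb{N}} \stackrel{\mathrm{law}}{=} \big(\langle \xi_i,\xi_j\rangle+\delta_{ij}a_i\big)_{i,j\in\mathbb{N}},\] where $\delta_{ij}$ is the Kronecker delta. Moreover, one may take $\mathfrak{H}=L^2[0,1)$, the real $L^2$ space of Lebesgue measure on $[0,1)$. -/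

import Mathlib

open MeasureTheory ProbabilityTheory
open scoped NNReal

/-- `σ` belongs to the group of permutations of `ℕ` that fix all but finitely many elements. -/
def IsFinitaryPerm (σ : Equiv.Perm ℕ) : Prop :=
  {i : ℕ | σ i ≠ i}.Finite

/-- A sequence of random variables is exchangeable: the law of the whole sequence is invariant
under all finitary permutations of the indices. -/
def IsExchangeableSeq {Ω E : Type*} [MeasurableSpace Ω] [MeasurableSpace E]
    (P : Measure Ω) (X : ℕ → Ω → E) : Prop :=
  ∀ σ : Equiv.Perm ℕ, IsFinitaryPerm σ →
    IdentDistrib (fun ω (i : ℕ) => X (σ i) ω) (fun ω (i : ℕ) => X i ω) P P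

/-- A random infinite matrix is (jointly) exchangeable: its law is invariant under simultaneous
finitary permutations of the rows and of the columns. -/
def IsJointlyExchangeable {Ω : Type*} [MeasurableSpace Ω]
    (P : Measure Ω) (R : Ω → ℕ → ℕ → ℝ) : Prop :=
  ∀ σ : Equiv.Perm ℕ, IsFinitaryPerm σ →
    IdentDistrib (fun ω i j => R ω (σ i) (σ j)) R P P

/-- The matrix with entries `⟪x i, x j⟫ + δ i j * a i`. -/
noncomputable def gramPlusDiagonal {H : Type*} [NormedAddCommGroup H] [InnerProductSpace ℝ H]
    (x : ℕ → H) (a : ℕ → ℝ≥0) : ℕ → ℕ → ℝ :=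
  fun i j => inner ℝ (x i) (x j) + if i = j then (a i : ℝ) else 0

/-- On some probability space there is an exchangeable sequence `(ξ i, a i)` of random variables
with values in `H × [0, ∞)` such that `R` has the same law as `(⟪ξ i, ξ j⟫ + δ i j * a i)`. -/
def HasExchangeableGramRepresentation {Ω : Type*} [MeasurableSpace Ω] (P : Measure Ω)
    (R : Ω → ℕ → ℕ → ℝ) (H : Type*) [NormedAddCommGroup H] [InnerProductSpace ℝ H]
    [MeasurableSpace H] [BorelSpace H] : Prop :=
  ∃ (Ω' : Type) (_ : MeasurableSpace Ω') (P' : Measure Ω') (_ : IsProbabilityMeasure P')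
    (ξ : ℕ → Ω' → H) (a : ℕ → Ω' → ℝ≥0),
    (∀ i, Measurable (ξ i)) ∧ (∀ i, Measurable (a i)) ∧
    IsExchangeableSeq P' (fun i ω => (ξ i ω, a i ω)) ∧
    IdentDistrib R (fun ω => gramPlusDiagonal (fun i => ξ i ω) (fun i => a i ω)) P P'

/-- The real Hilbert space `L²[0,1)` with respect to Lebesgue measure. -/
abbrev L2UnitInterval : Type :=
  Lp ℝ 2 ((volume : Measure ℝ).restrict (Set.Ico 0 1))

noncomputable instance L2UnitInterval.instMeasurableSpace : MeasurableSpace L2UnitInterval :=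
  borel L2UnitInterval

instance L2UnitInterval.instBorelSpace : BorelSpace L2UnitInterval := ⟨rfl⟩

/-! Rescaling index `i` by `(1 + R i i)^(-1/2)` makes the entries bounded by one and is undone by a
measurable map, so bounded matrices suffice. Diagonalize the leading `n × n` block with decreasing
eigenvalues. The trace is at most `n`, so the `k`-th eigenvalue, counting from zero, is at most `n /
(k + 1)`. Keeping `m` eigencoordinates then costs at most `n ^ 2 / (m + 1)` in squared Frobenius
norm (`Matrix.PosSemidef.exists_gram_approximation`).

A uniformly random relabelling of the `n` indices turns this average over entries into a bound `2 /
(m + 1)` at each fixed off-diagonal entry, uniformly in `n`. By joint exchangeability it leaves the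
law of the matrix unchanged. As `n → ∞`, coordinates and matrix together have a limit law on a
compact space (`CoordArray.exists_exchangeable_law`). It is exchangeable, has the given matrix
marginal, and keeps the bound for every `m`, so off-diagonal entries are exactly inner products.

The diagonal is a negligible share of the entries, so only `‖x i‖ ^ 2 ≤ M i i` survives there; the
deficit is `a i`. Eigenvectors need not be chosen measurably: the limit is taken with a finitely
additive expectation, and Riesz–Markov–Kakutani returns a genuine measure. -/

/-! ### Spectral truncation of finite matrices -/

open Finset in
/-- Summing over `Fin n` the terms of index less than `m`. -/
theorem Fin.sum_range_dite {n : ℕ} (f : Fin n → ℝ) (m : ℕ) :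
    ∑ k ∈ range m, (if h : k < n then f ⟨k, h⟩ else 0) = ∑ k : Fin n, if (k : ℕ) < m then f k else 0 := by
  induction m with
  | zero => simp
  | succ m ih =>
    rw [sum_range_succ, ih]
    have h1 : ∀ k : Fin n, (if (k : ℕ) < m + 1 then f k else 0)
        = (if (k : ℕ) < m then f k else 0) + if (k : ℕ) = m then f k else 0 := by
      intro k
      by_cases h : (k : ℕ) < m
      · simp [h, h.ne, Nat.lt_succ_of_lt h]
      · by_cases h' : (k : ℕ) = m
        · simp [h']
        · have : ¬ (k : ℕ) < m + 1 := by omega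
          simp [h, h', this]
    rw [sum_congr rfl fun k _ => h1 k, sum_add_distrib]
    congr 1
    split_ifs with h
    · rw [sum_eq_single ⟨m, h⟩]
      · simp
      · intro b _ hb
        rw [if_neg fun h' => hb (Fin.ext h')]
      · simp
    · refine (sum_eq_zero fun k _ => ?_).symm
      rw [if_neg]
      have := k.2
      omega

/-- A positive semidefinite real matrix is diagonalized by an orthogonal matrix, with the
eigenvalues in decreasing order. -/
theorem Matrix.PosSemidef.exists_antitone_diagonalization {n : ℕ} {A : Matrix (Fin n) (Fin n) ℝ}
    (hA : A.PosSemidef) :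
    ∃ (d : Fin n → ℝ) (W : Matrix (Fin n) (Fin n) ℝ), Antitone d ∧ (∀ k, 0 ≤ d k) ∧
      W.transpose * W = 1 ∧ A = W * Matrix.diagonal d * W.transpose := by
  let U : Matrix (Fin n) (Fin n) ℝ := hA.1.eigenvectorUnitary
  have hU : U.transpose * U = 1 := by
    have := Unitary.coe_star_mul_self hA.1.eigenvectorUnitary
    rwa [Matrix.star_eq_conjTranspose, Matrix.conjTranspose_eq_transpose_of_trivial] at this
  let e := Tuple.sort fun k => -hA.1.eigenvalues k
  have he : Monotone fun k => -hA.1.eigenvalues (e k) :=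
    Tuple.monotone_sort fun k => -hA.1.eigenvalues k
  refine ⟨fun k => hA.1.eigenvalues (e k), U.submatrix id e, fun a b h => neg_le_neg_iff.1 (he h),
    fun k => hA.eigenvalues_nonneg _, ?_, ?_⟩
  · rw [Matrix.transpose_submatrix, Matrix.submatrix_mul _ _ _ _ _ Function.bijective_id |>.symm, hU]
    simp
  · have h1 := hA.1.spectral_theorem
    rw [Unitary.conjStarAlgAut_apply, Matrix.star_eq_conjTranspose,
      Matrix.conjTranspose_eq_transpose_of_trivial] at h1
    have h2 : (Matrix.diagonal fun k => hA.1.eigenvalues (e k))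
        = (Matrix.diagonal (RCLike.ofReal ∘ hA.1.eigenvalues : Fin n → ℝ)).submatrix e e := by
      ext i j
      simp [Matrix.diagonal_apply]
    rw [h2, Matrix.transpose_submatrix, Matrix.submatrix_mul_equiv, Matrix.submatrix_mul_equiv]
    simpa using h1

/-- Frobenius norm of a matrix diagonalized by an orthogonal matrix. -/
theorem Matrix.sum_sq_mul_diagonal_mul_transpose {n : ℕ} (c : Fin n → ℝ)
    {W : Matrix (Fin n) (Fin n) ℝ} (hW : W.transpose * W = 1) :
    ∑ i, ∑ j, ((W * Matrix.diagonal c * W.transpose) i j) ^ 2 = ∑ k, c k ^ 2 := by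
  set B := W * Matrix.diagonal c * W.transpose with hB
  have h1 : ∑ i, ∑ j, (B i j) ^ 2 = (B * B.transpose).trace := by
    simp [Matrix.trace, Matrix.mul_apply, sq]
  have h2 : B * B.transpose = W * (Matrix.diagonal c * Matrix.diagonal c) * W.transpose := by
    rw [hB]
    simp only [Matrix.transpose_mul, Matrix.transpose_transpose, Matrix.diagonal_transpose]
    calc _ = W * Matrix.diagonal c * (W.transpose * W) * Matrix.diagonal c * W.transpose := by
          simp only [Matrix.mul_assoc]
      _ = _ := by rw [hW]; simp only [Matrix.mul_assoc, Matrix.mul_one]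
  rw [h1, h2, Matrix.trace_mul_comm, ← Matrix.mul_assoc, hW, Matrix.one_mul,
    Matrix.diagonal_mul_diagonal, Matrix.trace_diagonal]
  simp [sq]

open Finset in
/-- A positive semidefinite matrix with diagonal at most one is a Gram matrix whose partial sums of
coordinates approximate it at a rate that is uniform in the size, in the normalized `L²` sense. -/
theorem Matrix.PosSemidef.exists_gram_approximation {n : ℕ} {A : Matrix (Fin n) (Fin n) ℝ}
    (hA : A.PosSemidef) (hdiag : ∀ i, A i i ≤ 1) :
    ∃ v : Fin n → ℕ → ℝ, (∀ i m, ∑ k ∈ range m, v i k ^ 2 ≤ A i i) ∧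
      ∀ m : ℕ, ∑ i, ∑ j, (A i j - ∑ k ∈ range m, v i k * v j k) ^ 2 ≤ (n : ℝ) ^ 2 / (m + 1) := by
  obtain ⟨d, W, hd, hd0, hW, hAW⟩ := hA.exists_antitone_diagonalization
  have hentry : ∀ (c : Fin n → ℝ) i j,
      (W * Matrix.diagonal c * W.transpose) i j = ∑ k, c k * (W i k * W j k) := by
    intro c i j
    rw [Matrix.mul_apply]
    refine sum_congr rfl fun k _ => ?_
    rw [Matrix.mul_diagonal, Matrix.transpose_apply]
    ring
  have hAe : ∀ i j, A i j = ∑ k, d k * (W i k * W j k) := fun i j => by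
    rw [← hentry, ← hAW]
  have hsum : ∑ k, d k ≤ n := by
    have h1 : A.trace = ∑ k, d k := by
      rw [hAW, Matrix.trace_mul_comm, ← Matrix.mul_assoc, hW, Matrix.one_mul,
        Matrix.trace_diagonal]
    rw [← h1]
    calc A.trace = ∑ i, A i i := rfl
      _ ≤ ∑ _i : Fin n, (1 : ℝ) := sum_le_sum fun i _ => hdiag i
      _ = n := by simp
  -- Padding by zero beyond `n` lets `m` be arbitrary.
  let v : Fin n → ℕ → ℝ := fun i k => if h : k < n then √(d ⟨k, h⟩) * W i ⟨k, h⟩ else 0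
  have hv : ∀ i j m, ∑ k ∈ range m, v i k * v j k
      = ∑ k : Fin n, if (k : ℕ) < m then d k * (W i k * W j k) else 0 := by
    intro i j m
    rw [← Fin.sum_range_dite]
    refine sum_congr rfl fun k _ => ?_
    by_cases h : k < n
    · simp only [v, h, dif_pos]
      calc _ = (√(d ⟨k, h⟩) * √(d ⟨k, h⟩)) * (W i ⟨k, h⟩ * W j ⟨k, h⟩) := by ring
        _ = _ := by rw [Real.mul_self_sqrt (hd0 _)]
    · simp [v, h]
  refine ⟨v, fun i m => ?_, fun m => ?_⟩
  · simp only [sq]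
    rw [hv, hAe]
    refine sum_le_sum fun k _ => ?_
    split_ifs
    · exact le_rfl
    · exact mul_nonneg (hd0 k) (mul_self_nonneg _)
  -- The spectrum of the remainder: the `m` largest eigenvalues are deleted.
  · let c : Fin n → ℝ := fun k => if (k : ℕ) < m then 0 else d k
    have h1 : ∀ i j, A i j - ∑ k ∈ range m, v i k * v j k
        = (W * Matrix.diagonal c * W.transpose) i j := by
      intro i j
      rw [hv, hAe, hentry, ← sum_sub_distrib]
      refine sum_congr rfl fun k _ => ?_
      by_cases h : (k : ℕ) < m <;> simp [c, h]
    simp only [h1]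
    rw [Matrix.sum_sq_mul_diagonal_mul_transpose c hW]
    -- For `k ≥ m`, the `k + 1` eigenvalues of index at most `k` are each at least `d k` and sum to
    -- at most `n`.
    have hc : ∀ k, c k ≤ n / (m + 1) := by
      intro k
      by_cases h : (k : ℕ) < m
      · simp only [c, h, if_true]; positivity
      · simp only [c, h, if_false]
        rw [le_div_iff₀ (by positivity)]
        calc d k * (m + 1) ≤ d k * (k + 1) := by
              have : (m : ℝ) ≤ k := by exact_mod_cast not_lt.1 h
              exact mul_le_mul_of_nonneg_left (by linarith) (hd0 k)
          _ = ∑ _l ∈ Iic k, d k := by simp [mul_comm]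
          _ ≤ ∑ l ∈ Iic k, d l := sum_le_sum fun l hl => hd (mem_Iic.1 hl)
          _ ≤ ∑ l, d l := sum_le_sum_of_subset_of_nonneg (subset_univ _) fun l _ _ => hd0 l
          _ ≤ n := hsum
    calc ∑ k, c k ^ 2 ≤ ∑ k, n / (m + 1) * d k := by
          refine sum_le_sum fun k _ => ?_
          by_cases h : (k : ℕ) < m
          · simp only [c, h, if_true]
            rw [zero_pow two_ne_zero]
            exact mul_nonneg (by positivity) (hd0 k)
          · have := hc k
            simp only [c, h, if_false] at this ⊢
            rw [sq]
            exact mul_le_mul_of_nonneg_right this (hd0 k)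
      _ = n / (m + 1) * ∑ k, d k := (mul_sum _ _ _).symm
      _ ≤ n / (m + 1) * n := by gcongr
      _ = _ := by ring

/-! ### Limits of laws without measurability -/

/-- The bounded real functions on a type. -/
def boundedRealFunctions (S : Type*) : Submodule ℝ (S → ℝ) where
  carrier := {g | ∃ C, ∀ s, |g s| ≤ C}
  add_mem' := by
    rintro f g ⟨C, hC⟩ ⟨D, hD⟩
    exact ⟨C + D, fun s => (abs_add_le _ _).trans (add_le_add (hC s) (hD s))⟩
  zero_mem' := ⟨0, fun s => by simp⟩
  smul_mem' := by
    rintro c f ⟨C, hC⟩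
    refine ⟨|c| * C, fun s => ?_⟩
    rw [Pi.smul_apply, smul_eq_mul, abs_mul]
    exact mul_le_mul_of_nonneg_left (hC s) (abs_nonneg c)

/-- There is a finitely additive expectation for all bounded sequences of (possibly nonmeasurable)
functions on a probability space, which only depends on the tail of the sequence and extends the
integral. -/
theorem exists_finitelyAdditive_expectation {Ω : Type*} [MeasurableSpace Ω] (P : Measure Ω)
    [IsProbabilityMeasure P] :
    ∃ Λ : boundedRealFunctions (ℕ × Ω) →ₗ[ℝ] ℝ,
      (∀ g : boundedRealFunctions (ℕ × Ω), (∀ p, 0 ≤ g.1 p) → 0 ≤ Λ g) ∧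
      ∀ (g : boundedRealFunctions (ℕ × Ω)) (c : ℝ),
        (∀ᶠ n in Filter.atTop, Measurable (fun ω => g.1 (n, ω)) ∧ ∫ ω, g.1 (n, ω) ∂P = c) →
        Λ g = c := by
  let E := boundedRealFunctions (ℕ × Ω)
  let Q : E → ℝ → Prop := fun g c =>
    ∀ᶠ n in Filter.atTop, Measurable (fun ω => g.1 (n, ω)) ∧ ∫ ω, g.1 (n, ω) ∂P = c
  have hint : ∀ (g : E) n, Measurable (fun ω => g.1 (n, ω)) →
      Integrable (fun ω => g.1 (n, ω)) P := by
    intro g n hg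
    obtain ⟨C, hC⟩ := g.2
    exact Integrable.of_bound hg.aestronglyMeasurable C (Filter.Eventually.of_forall fun ω => hC _)
  have huniq : ∀ g c c', Q g c → Q g c' → c = c' := by
    intro g c c' h h'
    obtain ⟨n, hn, hn'⟩ := (h.and h').exists
    rw [← hn.2, ← hn'.2]
  have hadd : ∀ f g c d, Q f c → Q g d → Q (f + g) (c + d) := by
    intro f g c d hf hg
    filter_upwards [hf, hg] with n hf hg
    refine ⟨hf.1.add hg.1, ?_⟩
    rw [← hf.2, ← hg.2]
    exact integral_add (hint f n hf.1) (hint g n hg.1)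
  have hsmul : ∀ (a : ℝ) f c, Q f c → Q (a • f) (a * c) := by
    intro a f c hf
    filter_upwards [hf] with n hf
    refine ⟨hf.1.const_mul a, ?_⟩
    rw [← hf.2]
    exact integral_const_mul a _
  let D : Submodule ℝ E :=
    { carrier := {g | ∃ c, Q g c}
      add_mem' := by
        rintro f g ⟨c, hc⟩ ⟨d, hd⟩
        exact ⟨_, hadd f g c d hc hd⟩
      zero_mem' := ⟨0, Filter.Eventually.of_forall fun n => ⟨measurable_const, by simp⟩⟩
      smul_mem' := by
        rintro a f ⟨c, hc⟩
        exact ⟨_, hsmul a f c hc⟩ }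
  have hD : ∀ g : D, Q g g.2.choose := fun g => g.2.choose_spec
  let F : E →ₗ.[ℝ] ℝ :=
    { domain := D
      toFun :=
        { toFun := fun g => g.2.choose
          map_add' := fun f g => huniq _ _ _ (hD (f + g)) (hadd _ _ _ _ (hD f) (hD g))
          map_smul' := fun a f => huniq _ _ _ (hD (a • f)) (hsmul _ _ _ (hD f)) } }
  have hF : ∀ g : F.domain, Q g (F g) := hD
  let s : PointedCone ℝ E :=
    { carrier := {g | ∀ p, 0 ≤ g.1 p}
      add_mem' := fun {f g} hf hg p => add_nonneg (hf p) (hg p)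
      zero_mem' := fun p => le_rfl
      smul_mem' := fun a f hf p => mul_nonneg a.2 (hf p) }
  have hconst : ∀ C : ℝ, (fun _ => C : ℕ × Ω → ℝ) ∈ boundedRealFunctions (ℕ × Ω) :=
    fun C => ⟨|C|, fun _ => le_rfl⟩
  -- `F` is positive on its domain, and the domain contains the constants, which dominate every
  -- bounded function.
  obtain ⟨Λ, hΛ, hpos⟩ := riesz_extension s F (by
    intro g hg
    obtain ⟨n, hn⟩ := (hF g).exists
    rw [← hn.2]
    exact integral_nonneg fun ω => hg _) (by
    intro g
    obtain ⟨C, hC⟩ := g.2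
    refine ⟨⟨⟨_, hconst C⟩, C, Filter.Eventually.of_forall fun n => ⟨measurable_const, by simp⟩⟩,
      fun p => ?_⟩
    have := neg_le_of_abs_le (hC p)
    change 0 ≤ C + g.1 p
    linarith)
  refine ⟨Λ, hpos, fun g c hg => ?_⟩
  have h1 := hΛ ⟨g, c, hg⟩
  exact h1.trans (huniq _ _ _ (hF ⟨g, c, hg⟩) hg)

open CompactlySupported in
/-- The Riesz–Markov–Kakutani theorem on a compact space. -/
theorem exists_measure_integral_eq_of_compactSpace {K : Type*} [TopologicalSpace K] [T2Space K]
    [CompactSpace K] [MeasurableSpace K] [BorelSpace K] (L : C(K, ℝ) →ₗ[ℝ] ℝ)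
    (hL : ∀ f, 0 ≤ f → 0 ≤ L f) :
    ∃ μ : Measure K, IsFiniteMeasure μ ∧ ∀ f : C(K, ℝ), ∫ x, f x ∂μ = L f := by
  let T : C_c(K, ℝ) →ₗ[ℝ] ℝ :=
    { toFun := fun f => L f.toContinuousMap
      map_add' := fun f g => L.map_add _ _
      map_smul' := fun a f => L.map_smul _ _ }
  let T' : C_c(K, ℝ) →ₚ[ℝ] ℝ := PositiveLinearMap.mk₀ T fun f hf => hL _ hf
  refine ⟨RealRMK.rieszMeasure T', inferInstance, fun f => ?_⟩
  exact RealRMK.integral_rieszMeasure T' (CompactlySupportedContinuousMap.continuousMapEquiv f)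

/-- A sequence of families of normalized positive functionals on `C(K)`, indexed by a probability
space without any measurability assumption, has a limit point in expectation, which is the law of a
point of `K`. -/
theorem exists_probabilityMeasure_limit_expectation {Ω : Type*} [MeasurableSpace Ω] (P : Measure Ω)
    [IsProbabilityMeasure P] {K : Type*} [TopologicalSpace K] [T2Space K]
    [CompactSpace K] [MeasurableSpace K] [BorelSpace K] (T : ℕ → Ω → C(K, ℝ) →ₗ[ℝ] ℝ)
    (hpos : ∀ n ω f, 0 ≤ f → 0 ≤ T n ω f) (hone : ∀ n ω, T n ω 1 = 1) :
    ∃ μ : Measure K, IsProbabilityMeasure μ ∧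
      (∀ (f : C(K, ℝ)) (c : ℝ), (∀ᶠ n in Filter.atTop, ∀ ω, T n ω f ≤ c) → ∫ x, f x ∂μ ≤ c) ∧
      ∀ (f : C(K, ℝ)) (c : ℝ),
        (∀ᶠ n in Filter.atTop, Measurable (fun ω => T n ω f) ∧ ∫ ω, T n ω f ∂P = c) →
        ∫ x, f x ∂μ = c := by
  obtain ⟨Λ, hΛpos, hΛ⟩ := exists_finitelyAdditive_expectation P
  have hle : ∀ n ω f, T n ω f ≤ ‖f‖ := by
    intro n ω f
    have h1 : (0 : C(K, ℝ)) ≤ ‖f‖ • (1 : C(K, ℝ)) - f := fun x => by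
      simpa using (le_abs_self _).trans (f.norm_coe_le_norm x)
    have h2 := hpos n ω _ h1
    rw [map_sub, map_smul, hone, smul_eq_mul, mul_one] at h2
    linarith
  have hbdd : ∀ f, (fun p : ℕ × Ω => T p.1 p.2 f) ∈ boundedRealFunctions (ℕ × Ω) := by
    intro f
    refine ⟨‖f‖, fun p => abs_le.2 ⟨?_, hle _ _ f⟩⟩
    have := hle p.1 p.2 (-f)
    rw [map_neg, norm_neg] at this
    linarith
  let L : C(K, ℝ) →ₗ[ℝ] ℝ := Λ ∘ₗ
    { toFun := fun f => ⟨_, hbdd f⟩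
      map_add' := fun f g => Subtype.ext (funext fun p => (T p.1 p.2).map_add f g)
      map_smul' := fun a f => Subtype.ext (funext fun p => (T p.1 p.2).map_smul a f) }
  have hL : ∀ f, L f = Λ ⟨_, hbdd f⟩ := fun f => rfl
  obtain ⟨μ, hμ, hμL⟩ := exists_measure_integral_eq_of_compactSpace L
    fun f hf => hΛpos _ fun p => hpos _ _ f hf
  have hmeas : ∀ (f : C(K, ℝ)) (c : ℝ),
        (∀ᶠ n in Filter.atTop, Measurable (fun ω => T n ω f) ∧ ∫ ω, T n ω f ∂P = c) →
        ∫ x, f x ∂μ = c := by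
    intro f c h
    rw [hμL, hL]
    exact hΛ _ _ h
  refine ⟨μ, ⟨?_⟩, ?_, hmeas⟩
  · have h1 : ∫ x, (1 : C(K, ℝ)) x ∂μ = 1 :=
      hmeas 1 1 (Filter.Eventually.of_forall fun n => by simp [hone])
    simp only [ContinuousMap.one_apply, integral_const, smul_eq_mul, mul_one] at h1
    exact (ENNReal.toReal_eq_one_iff _).1 h1
  · intro f c h
    classical
    -- A majorant of `T n ω f` that does not depend on `ω` and equals `c` for large `n`, so its
    -- expectation is known even if `T n ω f` is not measurable.
    let b : ℕ × Ω → ℝ := fun p => if ∀ ω, T p.1 ω f ≤ c then c else ‖f‖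
    have hb : b ∈ boundedRealFunctions (ℕ × Ω) := by
      refine ⟨max |c| ‖f‖, fun p => ?_⟩
      simp only [b]
      split_ifs
      · exact le_max_left _ _
      · rw [abs_norm]
        exact le_max_right _ _
    have h1 : Λ ⟨b, hb⟩ = c := by
      refine hΛ _ _ ?_
      filter_upwards [h] with n hn
      simp [b, hn]
    have h2 : 0 ≤ Λ (⟨b, hb⟩ - ⟨_, hbdd f⟩) := by
      refine hΛpos _ fun p => ?_
      change 0 ≤ b p - T p.1 p.2 f
      simp only [b]
      split_ifs with hp
      · exact sub_nonneg.2 (hp p.2)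
      · exact sub_nonneg.2 (hle _ _ f)
    rw [map_sub, h1] at h2
    rw [hμL, hL]
    linarith

/-! ### Averaging over finite permutations -/

open Finset in
/-- The average over all permutations of a nonnegative function of two distinct entries is at most
its average over all ordered pairs of distinct indices. -/
theorem Equiv.Perm.sum_apply_apply_le {n : ℕ} {i j : Fin n} (hij : i ≠ j)
    (g : Fin n → Fin n → ℝ) (hg : ∀ a b, 0 ≤ g a b) :
    (n * (n - 1) : ℝ) * ∑ π : Equiv.Perm (Fin n), g (π i) (π j) ≤
      n.factorial * ∑ a, ∑ b, g a b := by
  have h1 : ∀ p ∈ (univ : Finset (Fin n)).offDiag,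
      ∑ π : Equiv.Perm (Fin n), g (π p.1) (π p.2) = ∑ π : Equiv.Perm (Fin n), g (π i) (π j) := by
    rintro ⟨a, b⟩ hab
    have hab : a ≠ b := (mem_offDiag.1 hab).2.2
    -- `τ` carries `(i, j)` to `(a, b)`; the second swap starts from where the first one sends `j`.
    let τ : Equiv.Perm (Fin n) := Equiv.swap (Equiv.swap i a j) b * Equiv.swap i a
    have hi : τ i = a := by
      rw [Equiv.Perm.mul_apply, Equiv.swap_apply_left, Equiv.swap_apply_of_ne_of_ne _ hab]
      intro h
      exact hij ((Equiv.swap i a).injective ((Equiv.swap_apply_left i a).trans h))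
    have hj : τ j = b := by
      rw [Equiv.Perm.mul_apply, Equiv.swap_apply_left]
    rw [← Equiv.sum_comp (Equiv.mulRight τ) fun π : Equiv.Perm (Fin n) => g (π i) (π j)]
    simp [hi, hj]
  have h2 : (n * (n - 1) : ℝ) = ((univ : Finset (Fin n)).offDiag.card : ℝ) := by
    rw [offDiag_card, card_univ, Fintype.card_fin, Nat.cast_sub (Nat.le_mul_self n)]
    push_cast
    ring
  calc (n * (n - 1) : ℝ) * ∑ π : Equiv.Perm (Fin n), g (π i) (π j)
      = ∑ p ∈ (univ : Finset (Fin n)).offDiag,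
          ∑ π : Equiv.Perm (Fin n), g (π p.1) (π p.2) := by
        rw [sum_congr rfl h1, sum_const, nsmul_eq_mul, h2]
    _ ≤ ∑ p : Fin n × Fin n, ∑ π : Equiv.Perm (Fin n), g (π p.1) (π p.2) :=
        sum_le_sum_of_subset_of_nonneg (subset_univ _) fun p _ _ => sum_nonneg fun π _ => hg _ _
    _ = ∑ π : Equiv.Perm (Fin n), ∑ a, ∑ b, g (π a) (π b) := by
        rw [sum_comm]
        exact sum_congr rfl fun π _ => Fintype.sum_prod_type _
    _ = ∑ _π : Equiv.Perm (Fin n), ∑ a, ∑ b, g a b := by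
        refine sum_congr rfl fun π _ => ?_
        rw [← Equiv.sum_comp π fun a => ∑ b, g a b]
        exact sum_congr rfl fun a _ => Equiv.sum_comp π (g (π a))
    _ = _ := by
        rw [sum_const, nsmul_eq_mul, card_univ, Fintype.card_perm, Fintype.card_fin]

/-- Permutations of the first `n` natural numbers, as permutations of `ℕ`. -/
noncomputable def Equiv.Perm.finToNat (n : ℕ) : Equiv.Perm (Fin n) →* Equiv.Perm ℕ :=
  Equiv.Perm.viaEmbeddingHom Fin.valEmbedding

theorem Equiv.Perm.finToNat_apply_coe {n : ℕ} (π : Equiv.Perm (Fin n)) (i : Fin n) :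
    finToNat n π i = π i :=
  Equiv.Perm.viaEmbedding_apply π Fin.valEmbedding i

theorem Equiv.Perm.finToNat_apply_of_le {n : ℕ} (π : Equiv.Perm (Fin n)) {i : ℕ} (hi : n ≤ i) :
    finToNat n π i = i :=
  Equiv.Perm.viaEmbedding_apply_of_notMem π Fin.valEmbedding i (by
    rintro ⟨k, rfl⟩
    exact absurd k.2 (not_lt.2 hi))

theorem Equiv.Perm.isFinitaryPerm_finToNat {n : ℕ} (π : Equiv.Perm (Fin n)) :
    IsFinitaryPerm (finToNat n π) :=
  (Set.finite_Iio n).subset fun i hi => by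
    by_contra h
    exact hi (finToNat_apply_of_le π (not_lt.1 h))

/-- Makes each finitary permutation an element of the group averaged over, for all large `n`, so
that the limit law inherits its invariance. -/
theorem IsFinitaryPerm.eventually_exists_finToNat {σ : Equiv.Perm ℕ} (hσ : IsFinitaryPerm σ) :
    ∀ᶠ n in Filter.atTop, ∃ π : Equiv.Perm (Fin n), Equiv.Perm.finToNat n π = σ := by
  obtain ⟨N, hN⟩ := hσ.bddAbove
  filter_upwards [Filter.eventually_gt_atTop N] with n hn
  have hfix : ∀ i, n ≤ i → σ i = i := by
    intro i hi
    by_contra h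
    exact absurd (hN h) (by omega)
  have hlt : ∀ i, i < n ↔ σ i < n := by
    intro i
    constructor
    · intro hi
      by_contra h
      have h1 := hfix _ (not_lt.1 h)
      exact h ((σ.injective h1).symm ▸ hi)
    · intro hi
      by_contra h
      exact h ((hfix i (not_lt.1 h)) ▸ hi)
  let π : Equiv.Perm (Fin n) :=
    { toFun := fun i => ⟨σ i, (hlt i).1 i.2⟩
      invFun := fun i => ⟨σ.symm i, (hlt _).2 (by simp)⟩
      left_inv := fun i => by simp
      right_inv := fun i => by simp }
  refine ⟨π, Equiv.ext fun i => ?_⟩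
  by_cases hi : i < n
  · exact Equiv.Perm.finToNat_apply_coe π ⟨i, hi⟩
  · rw [Equiv.Perm.finToNat_apply_of_le π (not_lt.1 hi), hfix i (not_lt.1 hi)]

/-! ### The compact space of coordinates and matrices -/

/-- The interval `[-1, 1]`. -/
abbrev SymmInterval : Type := Set.Icc (-1 : ℝ) 1

/-- A sequence of sequences of coordinates together with a matrix, all with entries in `[-1, 1]`. -/
abbrev CoordArray : Type := (ℕ → ℕ → SymmInterval) × (ℕ → ℕ → SymmInterval)

/-- Relabelling the indices of the sequence of coordinates and of the matrix. -/
def CoordArray.relabel (σ : Equiv.Perm ℕ) (z : CoordArray) : CoordArray :=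
  (fun i => z.1 (σ i), fun i j => z.2 (σ i) (σ j))

theorem CoordArray.continuous_relabel (σ : Equiv.Perm ℕ) : Continuous (relabel σ) := by
  unfold relabel
  fun_prop

/-- The coordinates `x` are such that `x i` has squared norm at most `M i i`, and such that the
inner product of `x i` and `x j` is `M i j` for `i ≠ j`. -/
def CoordArray.IsOffDiagonalGram (z : CoordArray) : Prop :=
  (∀ i m, ∑ k ∈ Finset.range m, (z.1 i k : ℝ) ^ 2 ≤ z.2 i i) ∧
    ∀ i j, i ≠ j → Filter.Tendsto (fun m => ∑ k ∈ Finset.range m, (z.1 i k : ℝ) * z.1 j k)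
      Filter.atTop (nhds (z.2 i j : ℝ))

/-- The difference between a matrix entry and the inner product of the truncated coordinates. -/
def CoordArray.offDiagonalError (i j m : ℕ) (z : CoordArray) : ℝ :=
  z.2 i j - ∑ k ∈ Finset.range m, (z.1 i k : ℝ) * z.1 j k

theorem CoordArray.continuous_offDiagonalError (i j m : ℕ) :
    Continuous (offDiagonalError i j m) := by
  unfold offDiagonalError
  fun_prop

theorem summable_mul_of_sum_range_sq_le {x y : ℕ → ℝ} {a b : ℝ}
    (hx : ∀ m, ∑ k ∈ Finset.range m, x k ^ 2 ≤ a) (hy : ∀ m, ∑ k ∈ Finset.range m, y k ^ 2 ≤ b) :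
    Summable fun k => x k * y k := by
  have h1 := summable_of_sum_range_le (fun k => sq_nonneg (x k)) hx
  have h2 := summable_of_sum_range_le (fun k => sq_nonneg (y k)) hy
  refine Summable.of_norm_bounded (h1.add h2) fun k => ?_
  rw [Real.norm_eq_abs, abs_le]
  constructor <;> nlinarith [sq_nonneg (x k + y k), sq_nonneg (x k - y k), sq_nonneg (x k),
    sq_nonneg (y k)]

theorem abs_sum_range_mul_le_one {x y : ℕ → ℝ} {m : ℕ}
    (hx : ∑ k ∈ Finset.range m, x k ^ 2 ≤ 1) (hy : ∑ k ∈ Finset.range m, y k ^ 2 ≤ 1) :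
    |∑ k ∈ Finset.range m, x k * y k| ≤ 1 := by
  rw [← sq_le_one_iff_abs_le_one]
  refine (Finset.sum_mul_sq_le_sq_mul_sq _ _ _).trans ?_
  exact mul_le_one₀ hx (Finset.sum_nonneg fun k _ => sq_nonneg _) hy

/-- If the truncation error tends to zero in mean square, then almost every array is an off-diagonal
Gram array. -/
theorem CoordArray.ae_isOffDiagonalGram {μ : Measure CoordArray} [IsProbabilityMeasure μ]
    (hdiag : ∀ i m, ∀ᵐ z : CoordArray ∂μ, ∑ k ∈ Finset.range m, (z.1 i k : ℝ) ^ 2 ≤ z.2 i i)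
    (hoff : ∀ i j m, i ≠ j → ∫ z, offDiagonalError i j m z ^ 2 ∂μ ≤ 2 / (m + 1)) :
    ∀ᵐ z ∂μ, IsOffDiagonalGram z := by
  have hdiag' : ∀ᵐ z : CoordArray ∂μ, ∀ i m, ∑ k ∈ Finset.range m, (z.1 i k : ℝ) ^ 2 ≤ z.2 i i :=
    ae_all_iff.2 fun i => ae_all_iff.2 fun m => hdiag i m
  refine hdiag'.and ?_
  refine ae_all_iff.2 fun i => ae_all_iff.2 fun j => ?_
  by_cases hij : i = j
  · exact Filter.Eventually.of_forall fun z h => absurd hij h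
  -- The limiting error: its mean square is at most `lim 2 / (m + 1) = 0`, by dominated convergence.
  let S : CoordArray → ℝ := fun z => z.2 i j - ∑' k, (z.1 i k : ℝ) * z.1 j k
  have hlim : ∀ᵐ z ∂μ, Filter.Tendsto (fun m => offDiagonalError i j m z) Filter.atTop
      (nhds (S z)) := by
    filter_upwards [hdiag'] with z hz
    exact tendsto_const_nhds.sub
      (summable_mul_of_sum_range_sq_le (hz i) (hz j)).hasSum.tendsto_sum_nat
  have hbound : ∀ m, ∀ᵐ z ∂μ, ‖offDiagonalError i j m z ^ 2‖ ≤ 4 := by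
    intro m
    filter_upwards [hdiag'] with z hz
    have h1 := abs_sum_range_mul_le_one ((hz i m).trans (z.2 i i).2.2)
      ((hz j m).trans (z.2 j j).2.2)
    have h2 : |(z.2 i j : ℝ)| ≤ 1 := abs_le.2 (z.2 i j).2
    have h3 : |offDiagonalError i j m z| ≤ 2 := by
      refine (abs_sub _ _).trans ?_
      linarith
    rw [norm_pow, Real.norm_eq_abs]
    nlinarith [abs_nonneg (offDiagonalError i j m z)]
  have hmeas : ∀ m, AEStronglyMeasurable (fun z => offDiagonalError i j m z ^ 2) μ := fun m =>
    ((continuous_offDiagonalError i j m).pow 2).aestronglyMeasurable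
  have htend := tendsto_integral_of_dominated_convergence (fun _ => (4 : ℝ)) hmeas
    (integrable_const _) hbound (hlim.mono fun z hz => hz.pow 2)
  have hzero : ∫ z, S z ^ 2 ∂μ = 0 := by
    refine tendsto_nhds_unique htend ?_
    have h2 : Filter.Tendsto (fun m : ℕ => (2 : ℝ) / (m + 1)) Filter.atTop (nhds 0) := by
      simpa [div_eq_mul_inv] using (tendsto_one_div_add_atTop_nhds_zero_nat (𝕜 := ℝ)).const_mul 2
    exact tendsto_of_tendsto_of_tendsto_of_le_of_le tendsto_const_nhds h2
      (fun m => integral_nonneg fun z => sq_nonneg _) fun m => hoff i j m hij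
  have hS : Integrable (fun z => S z ^ 2) μ := by
    refine Integrable.of_bound (aestronglyMeasurable_of_tendsto_ae Filter.atTop hmeas
      (hlim.mono fun z hz => hz.pow 2)) 4 ?_
    filter_upwards [hlim, ae_all_iff.2 hbound] with z hz hb
    exact le_of_tendsto (hz.pow 2).norm (Filter.Eventually.of_forall hb)
  rw [integral_eq_zero_iff_of_nonneg (fun z => sq_nonneg _) hS] at hzero
  filter_upwards [hzero, hdiag'] with z hz hz' _
  have h1 : S z = 0 := pow_eq_zero_iff two_ne_zero |>.1 hz
  have h2 : (z.2 i j : ℝ) = ∑' k, (z.1 i k : ℝ) * z.1 j k := sub_eq_zero.1 h1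
  rw [h2]
  exact (summable_mul_of_sum_range_sq_le (hz' i) (hz' j)).hasSum.tendsto_sum_nat

/-! ### Permutation averages and their limit law -/

/-- The average of a continuous function over the relabellings of the first `n` indices. -/
noncomputable def CoordArray.permAverage (n : ℕ) (z : CoordArray) : C(CoordArray, ℝ) →ₗ[ℝ] ℝ where
  toFun f := (n.factorial : ℝ)⁻¹ * ∑ π : Equiv.Perm (Fin n), f (relabel (π.finToNat n) z)
  map_add' f g := by simp [Finset.sum_add_distrib, mul_add]
  map_smul' a f := by simp [← Finset.mul_sum, mul_left_comm]

theorem CoordArray.permAverage_apply (n : ℕ) (z : CoordArray) (f : C(CoordArray, ℝ)) :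
    permAverage n z f =
      (n.factorial : ℝ)⁻¹ * ∑ π : Equiv.Perm (Fin n), f (relabel (π.finToNat n) z) := rfl

theorem CoordArray.permAverage_eq_of_forall {n : ℕ} {z : CoordArray} {f : C(CoordArray, ℝ)} {c : ℝ}
    (h : ∀ σ, f (relabel σ z) = c) : permAverage n z f = c := by
  rw [permAverage_apply]
  simp only [h, Finset.sum_const, nsmul_eq_mul, Finset.card_univ, Fintype.card_perm,
    Fintype.card_fin]
  rw [inv_mul_cancel_left₀ (by positivity)]

theorem CoordArray.permAverage_comp_relabel {n : ℕ} (τ : Equiv.Perm (Fin n)) (z : CoordArray)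
    (f : C(CoordArray, ℝ)) :
    permAverage n z (f.comp ⟨relabel (τ.finToNat n), continuous_relabel _⟩) =
      permAverage n z f := by
  rw [permAverage_apply, permAverage_apply,
    ← Equiv.sum_comp (Equiv.mulRight τ) fun π : Equiv.Perm (Fin n) =>
      f (relabel (π.finToNat n) z)]
  congr 1
  refine Finset.sum_congr rfl fun π _ => ?_
  simp [relabel]

-- A random permutation spreads `(i, j)` uniformly over ordered pairs of distinct indices. The
-- constant is `n ^ 2 / (n * (n - 1)) ≤ 2`, valid since distinct `i, j < n` force `n ≥ 2`.
open Finset in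
theorem CoordArray.permAverage_sq_offDiagonalError_le {n i j m : ℕ} (hi : i < n) (hj : j < n)
    (hij : i ≠ j) (z : CoordArray)
    (hz : ∑ a : Fin n, ∑ b : Fin n, offDiagonalError a b m z ^ 2 ≤ (n : ℝ) ^ 2 / (m + 1)) :
    permAverage n z ⟨fun z => offDiagonalError i j m z ^ 2,
      (continuous_offDiagonalError i j m).pow 2⟩ ≤ 2 / (m + 1) := by
  have hn : (2 : ℝ) ≤ n := by
    have : 2 ≤ n := by omega
    exact_mod_cast this
  have h1 := Equiv.Perm.sum_apply_apply_le (i := (⟨i, hi⟩ : Fin n)) (j := ⟨j, hj⟩)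
    (fun h => hij (Fin.mk.inj_iff.1 h)) (fun a b : Fin n => offDiagonalError a b m z ^ 2)
    fun a b => sq_nonneg _
  have h2 : ∀ π : Equiv.Perm (Fin n),
      offDiagonalError i j m (relabel (π.finToNat n) z) ^ 2
        = offDiagonalError (π ⟨i, hi⟩) (π ⟨j, hj⟩) m z ^ 2 := by
    intro π
    have hi' := π.finToNat_apply_coe ⟨i, hi⟩
    have hj' := π.finToNat_apply_coe ⟨j, hj⟩
    simp only at hi' hj'
    simp only [offDiagonalError, relabel, hi', hj']
  rw [permAverage_apply]
  simp only [ContinuousMap.coe_mk, h2]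
  set s := ∑ π : Equiv.Perm (Fin n), offDiagonalError (π ⟨i, hi⟩) (π ⟨j, hj⟩) m z ^ 2
  have hfac : (0 : ℝ) < n.factorial := by positivity
  rw [inv_mul_le_iff₀ hfac]
  have h3 : (n * (n - 1) : ℝ) * s ≤ (n * (n - 1) : ℝ) * (n.factorial * (2 / (m + 1))) := by
    calc (n * (n - 1) : ℝ) * s ≤ n.factorial * ((n : ℝ) ^ 2 / (m + 1)) :=
          h1.trans (mul_le_mul_of_nonneg_left hz hfac.le)
      _ = n.factorial * (1 / (m + 1)) * (n ^ 2 : ℝ) := by ring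
      _ ≤ n.factorial * (1 / (m + 1)) * (n * (n - 1) * 2 : ℝ) := by
          refine mul_le_mul_of_nonneg_left ?_ (by positivity)
          nlinarith
      _ = _ := by ring
  exact le_of_mul_le_mul_left h3 (by nlinarith)

/-- A positive semidefinite matrix with entries in `[-1, 1]` can be completed by coordinates such
that the truncation errors are small in normalized mean square. -/
theorem CoordArray.exists_coords (M : ℕ → ℕ → SymmInterval) (n : ℕ)
    (hM : (Matrix.of fun i j : Fin n => (M i j : ℝ)).PosSemidef) (hM0 : ∀ i, 0 ≤ (M i i : ℝ)) :
    ∃ x : ℕ → ℕ → SymmInterval,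
      (∀ i m, ∑ k ∈ Finset.range m, (x i k : ℝ) ^ 2 ≤ M i i) ∧
      ∀ m, ∑ a : Fin n, ∑ b : Fin n, offDiagonalError a b m (x, M) ^ 2 ≤ (n : ℝ) ^ 2 / (m + 1) := by
  obtain ⟨v, hv, hv'⟩ := hM.exists_gram_approximation fun i => (M i i).2.2
  have hmem : ∀ i k, v i k ∈ Set.Icc (-1 : ℝ) 1 := by
    intro i k
    rw [Set.mem_Icc, ← abs_le, ← sq_le_one_iff_abs_le_one]
    refine le_trans ?_ ((hv i (k + 1)).trans (M i i).2.2)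
    exact Finset.single_le_sum (f := fun k => v i k ^ 2) (fun k _ => sq_nonneg _)
      (Finset.self_mem_range_succ k)
  let x : ℕ → ℕ → SymmInterval := fun i k =>
    if h : i < n then ⟨v ⟨i, h⟩ k, hmem _ _⟩ else ⟨0, by simp⟩
  have hx : ∀ (i : Fin n) k, (x i k : ℝ) = v i k := by
    intro i k
    simp [x]
  refine ⟨x, fun i m => ?_, fun m => ?_⟩
  · by_cases h : i < n
    · have := hv ⟨i, h⟩ m
      simpa [x, h] using this
    · simpa [x, h] using hM0 i
  · simpa [offDiagonalError, hx] using hv' m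

/-- A bounded jointly exchangeable positive semidefinite array is the matrix of a random exchangeable
off-diagonal Gram array. -/
theorem CoordArray.exists_exchangeable_law {Ω : Type*} [MeasurableSpace Ω] (P : Measure Ω)
    [IsProbabilityMeasure P] (M : Ω → ℕ → ℕ → SymmInterval) (hmeas : Measurable M)
    (hpsd : ∀ ω n, (Matrix.of fun i j : Fin n => (M ω i j : ℝ)).PosSemidef)
    (hexch : ∀ σ, IsFinitaryPerm σ → IdentDistrib (fun ω i j => M ω (σ i) (σ j)) M P P) :
    ∃ μ : Measure CoordArray, IsProbabilityMeasure μ ∧ μ.map Prod.snd = P.map M ∧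
      (∀ σ, IsFinitaryPerm σ → μ.map (relabel σ) = μ) ∧ ∀ᵐ z ∂μ, IsOffDiagonalGram z := by
  have hdiag : ∀ ω i, 0 ≤ (M ω i i : ℝ) := fun ω i =>
    (hpsd ω (i + 1)).diag_nonneg (i := Fin.last i)
  -- This choice need not be measurable in `ω`.
  choose x hx hx' using fun n ω => exists_coords (M ω) n (hpsd ω n) (hdiag ω)
  obtain ⟨μ, hμ, hle, heq⟩ := exists_probabilityMeasure_limit_expectation P
    (fun n ω => permAverage n (x n ω, M ω))
    (fun n ω f hf => by
      rw [permAverage_apply]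
      exact mul_nonneg (by positivity) (Finset.sum_nonneg fun π _ => hf _))
    (fun n ω => permAverage_eq_of_forall fun σ => rfl)
  refine ⟨μ, hμ, ?_, ?_, ae_isOffDiagonalGram ?_ ?_⟩
  -- A test function of the matrix alone does not see `x`, so its average is measurable; joint
  -- exchangeability gives every summand the same integral.
  · have := Measure.isProbabilityMeasure_map (μ := P) hmeas.aemeasurable
    have := Measure.isProbabilityMeasure_map (μ := μ) (f := (Prod.snd : CoordArray → _))
      measurable_snd.aemeasurable
    refine ext_of_forall_integral_eq_of_IsFiniteMeasure fun f => ?_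
    rw [integral_map measurable_snd.aemeasurable f.continuous.aestronglyMeasurable,
      integral_map hmeas.aemeasurable f.continuous.aestronglyMeasurable]
    have hfσ : ∀ σ : Equiv.Perm ℕ, Measurable fun ω => f fun i j => M ω (σ i) (σ j) := by
      intro σ
      refine f.continuous.measurable.comp ?_
      fun_prop
    refine heq (f.toContinuousMap.comp ⟨Prod.snd, continuous_snd⟩) _
      (Filter.Eventually.of_forall fun n => ⟨?_, ?_⟩)
    · simp only [permAverage_apply]
      exact (Finset.measurable_sum _ fun π _ => hfσ _).const_mul _
    · simp only [permAverage_apply]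
      rw [integral_const_mul, integral_finsetSum]
      · have h1 : ∀ π : Equiv.Perm (Fin n),
            ∫ ω, (f.toContinuousMap.comp ⟨Prod.snd, continuous_snd⟩ : C(CoordArray, ℝ))
              (relabel (π.finToNat n) (x n ω, M ω)) ∂P = ∫ ω, f (M ω) ∂P := fun π =>
          ((hexch _ π.isFinitaryPerm_finToNat).comp f.continuous.measurable).integral_eq
        rw [Finset.sum_congr rfl fun π _ => h1 π, Finset.sum_const, nsmul_eq_mul,
          Finset.card_univ, Fintype.card_perm, Fintype.card_fin,
          inv_mul_cancel_left₀ (by positivity)]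
      · exact fun π _ => Integrable.of_bound (hfσ _).aestronglyMeasurable ‖f‖
          (Filter.Eventually.of_forall fun ω => f.norm_coe_le_norm _)
  · intro σ hσ
    have hm : Measurable (relabel σ) := (continuous_relabel σ).measurable
    have := Measure.isProbabilityMeasure_map (μ := μ) hm.aemeasurable
    refine ext_of_forall_integral_eq_of_IsFiniteMeasure fun f => ?_
    rw [integral_map hm.aemeasurable f.continuous.aestronglyMeasurable]
    let g : C(CoordArray, ℝ) := f.toContinuousMap.comp ⟨relabel σ, continuous_relabel σ⟩
    -- Once `σ` lies in the group, `g` and `f` have the same average for every `ω`, so the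
    -- difference averages to the constant zero.
    have h1 : ∫ z, (g - f.toContinuousMap) z ∂μ = 0 := by
      refine heq _ _ ?_
      filter_upwards [hσ.eventually_exists_finToNat] with n hn
      obtain ⟨τ, rfl⟩ := hn
      simp [g, permAverage_comp_relabel]
    have h2 : ∀ f : C(CoordArray, ℝ), Integrable f μ := fun f =>
      Integrable.of_bound f.continuous.aestronglyMeasurable ‖f‖
        (Filter.Eventually.of_forall fun z => f.norm_coe_le_norm z)
    exact sub_eq_zero.1 ((integral_sub (h2 g) (h2 f.toContinuousMap)).symm.trans h1)
  · intro i m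
    -- A continuous function that vanishes exactly where the inequality holds. It is zero on all
    -- relabellings, since `hx` covers every index.
    let d : CoordArray → ℝ := fun z => max 0 (∑ k ∈ Finset.range m, (z.1 i k : ℝ) ^ 2 - z.2 i i)
    have hd : Continuous d := by
      simp only [d]
      fun_prop
    have h1 : ∫ z, d z ∂μ = 0 := by
      refine heq ⟨d, hd⟩ 0 (Filter.Eventually.of_forall fun n => ?_)
      have h2 : ∀ ω, permAverage n (x n ω, M ω) ⟨d, hd⟩ = 0 := fun ω =>
        permAverage_eq_of_forall fun σ => max_eq_left (sub_nonpos.2 (hx n ω (σ i) m))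
      simp [h2]
    have h2 : Integrable d μ := Integrable.of_bound hd.aestronglyMeasurable
      ‖(⟨d, hd⟩ : C(CoordArray, ℝ))‖
      (Filter.Eventually.of_forall fun z => (⟨d, hd⟩ : C(CoordArray, ℝ)).norm_coe_le_norm z)
    have h0 : 0 ≤ d := fun z => le_max_left _ _
    rw [integral_eq_zero_iff_of_nonneg h0 h2] at h1
    filter_upwards [h1] with z hz
    exact sub_nonpos.1 ((le_max_right _ _).trans_eq hz)
  · intro i j m hij
    refine hle ⟨_, (continuous_offDiagonalError i j m).pow 2⟩ _ ?_
    filter_upwards [Filter.eventually_gt_atTop i, Filter.eventually_gt_atTop j] with n hi hj ω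
    exact permAverage_sq_offDiagonalError_le hi hj hij _ (hx' n ω m)

/-! ### Vectors from square-summable coordinates -/

theorem L2UnitInterval.exists_orthonormal : ∃ e : ℕ → L2UnitInterval, Orthonormal ℝ e := by
  let f : ℕ → ℝ := fun n => 1 / ((n : ℝ) + 1)
  have hf : StrictAnti f := fun a b h =>
    one_div_lt_one_div_of_lt (by positivity) (by exact_mod_cast Nat.succ_lt_succ h)
  -- Disjoint intervals `[1/(n+2), 1/(n+1))`, whose normalized indicators are orthonormal.
  let s : ℕ → Set ℝ := fun n => Set.Ico (f (Order.succ n)) (f n)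
  have hs : ∀ n, MeasurableSet (s n) := fun n => measurableSet_Ico
  let ν : Measure ℝ := (volume : Measure ℝ).restrict (Set.Ico 0 1)
  have hsub : ∀ n, s n ⊆ Set.Ico 0 1 := by
    refine fun n => Set.Ico_subset_Ico ?_ ?_
    · simp only [f]; positivity
    · simpa [f] using hf.antitone (Nat.zero_le n)
  have hν : ∀ n, 0 < ν.real (s n) := by
    intro n
    have h1 : ν (s n) = volume (s n) := by
      rw [Measure.restrict_apply (hs n), Set.inter_eq_left.2 (hsub n)]
    rw [Measure.real, h1, Real.volume_Ico]
    have h2 := hf (Order.lt_succ n)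
    rw [ENNReal.toReal_ofReal (by linarith)]
    linarith
  refine ⟨fun n => indicatorConstLp 2 (hs n) (measure_ne_top ν _) (√(ν.real (s n)))⁻¹, ?_⟩
  rw [orthonormal_iff_ite]
  intro i j
  rw [L2.inner_indicatorConstLp_indicatorConstLp]
  split_ifs with hij
  · subst hij
    rw [Set.inter_self]
    have h1 := Real.mul_self_sqrt (hν i).le
    have h2 := (Real.sqrt_pos.2 (hν i)).ne'
    simp only [real_inner_self_eq_norm_sq, Real.norm_eq_abs, sq_abs, smul_eq_mul]
    nth_rewrite 1 [← h1]
    field_simp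
  · have h1 : s i ∩ s j = ∅ :=
      Set.disjoint_iff_inter_eq_empty.1 (hf.antitone.pairwise_disjoint_on_Ico_succ hij)
    simp [h1]

section OrthonormalSeries

variable {H : Type*} [NormedAddCommGroup H] [InnerProductSpace ℝ H]

/-- The sequences with entries in `[-1, 1]` whose sum of squares is at most one. -/
def squareSumLeOne : Set (ℕ → SymmInterval) :=
  {x | ∀ m, ∑ k ∈ Finset.range m, (x k : ℝ) ^ 2 ≤ 1}

theorem measurableSet_squareSumLeOne : MeasurableSet squareSumLeOne := by
  simp only [squareSumLeOne, Set.ofPred_forall]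
  refine MeasurableSet.iInter fun m => measurableSet_le ?_ measurable_const
  fun_prop

open Classical in
/-- The vector with given coordinates along an orthonormal sequence. -/
noncomputable def orthonormalSeries (e : ℕ → H) (x : ℕ → SymmInterval) : H :=
  if x ∈ squareSumLeOne then ∑' k, (x k : ℝ) • e k else 0

variable [CompleteSpace H] {e : ℕ → H}

theorem Orthonormal.tendsto_sum_orthonormalSeries (he : Orthonormal ℝ e) {x : ℕ → SymmInterval}
    (hx : x ∈ squareSumLeOne) :
    Filter.Tendsto (fun m => ∑ k ∈ Finset.range m, (x k : ℝ) • e k) Filter.atTop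
      (nhds (orthonormalSeries e x)) := by
  rw [orthonormalSeries, if_pos hx]
  refine Summable.tendsto_sum_tsum_nat ?_
  have h1 := he.orthogonalFamily.summable_iff_norm_sq_summable fun k => (x k : ℝ)
  simp only [LinearIsometry.toSpanSingleton_apply] at h1
  refine h1.2 (summable_of_sum_range_le (c := 1) (fun k => sq_nonneg _) fun m => ?_)
  simpa using hx m

theorem Orthonormal.tendsto_sum_inner_orthonormalSeries (he : Orthonormal ℝ e)
    {x y : ℕ → SymmInterval} (hx : x ∈ squareSumLeOne) (hy : y ∈ squareSumLeOne) :
    Filter.Tendsto (fun m => ∑ k ∈ Finset.range m, (x k : ℝ) * y k) Filter.atTop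
      (nhds (inner ℝ (orthonormalSeries e x) (orthonormalSeries e y))) := by
  refine ((he.tendsto_sum_orthonormalSeries hx).inner
    (he.tendsto_sum_orthonormalSeries hy)).congr fun m => ?_
  rw [he.inner_sum]
  simp

theorem Orthonormal.measurable_orthonormalSeries [MeasurableSpace H] [BorelSpace H]
    (he : Orthonormal ℝ e) : Measurable (orthonormalSeries e) := by
  classical
  refine measurable_of_tendsto_metrizable (f := fun m (x : ℕ → SymmInterval) =>
    if x ∈ squareSumLeOne then ∑ k ∈ Finset.range m, (x k : ℝ) • e k else 0) (fun m => ?_) ?_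
  · refine Measurable.ite measurableSet_squareSumLeOne (Continuous.measurable ?_) measurable_const
    fun_prop
  · rw [tendsto_pi_nhds]
    intro x
    by_cases hx : x ∈ squareSumLeOne
    · simpa [hx] using he.tendsto_sum_orthonormalSeries hx
    · simp [hx, orthonormalSeries]

end OrthonormalSeries

/-! ### Rescaling to bounded entries -/

/-- The scale factor of an index of a real matrix in the passage to a bounded matrix. -/
noncomputable def contractionFactor (A : ℕ → ℕ → ℝ) (i : ℕ) : ℝ := (√(1 + A i i))⁻¹

/-- Rescaling the indices of a positive semidefinite matrix so that its entries are in `[-1, 1]`. -/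
noncomputable def contractMatrix (A : ℕ → ℕ → ℝ) (i j : ℕ) : SymmInterval :=
  Set.projIcc (-1) 1 (by norm_num) (contractionFactor A i * A i j * contractionFactor A j)

/-- The scale factor that inverts `contractionFactor`. -/
noncomputable def expansionFactor (s : SymmInterval) : ℝ := (√(1 - s))⁻¹

/-- The inverse of `contractMatrix`. -/
noncomputable def expandMatrix (M : ℕ → ℕ → SymmInterval) (i j : ℕ) : ℝ :=
  expansionFactor (M i i) * M i j * expansionFactor (M j j)

theorem measurable_expansionFactor : Measurable expansionFactor := by
  unfold expansionFactor
  fun_prop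

theorem measurable_contractMatrix : Measurable contractMatrix := by
  refine measurable_pi_lambda _ fun i => measurable_pi_lambda _ fun j => ?_
  refine continuous_projIcc.measurable.comp ?_
  unfold contractionFactor
  fun_prop

theorem measurable_expandMatrix : Measurable expandMatrix := by
  refine measurable_pi_lambda _ fun i => measurable_pi_lambda _ fun j => ?_
  unfold expandMatrix
  have := measurable_expansionFactor
  fun_prop

/-- The projection onto `[-1, 1]` is inactive: the `2 × 2` minor gives `A i j ^ 2 ≤ A i i * A j j ≤
(1 + A i i) * (1 + A j j)`. -/
theorem coe_contractMatrix {A : ℕ → ℕ → ℝ} (hA : (Matrix.of A).PosSemidef) (i j : ℕ) :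
    (contractMatrix A i j : ℝ) = contractionFactor A i * A i j * contractionFactor A j := by
  have hi : 0 ≤ A i i := hA.diag_nonneg
  have hj : 0 ≤ A j j := hA.diag_nonneg
  have hsymm : A j i = A i j := by simpa using hA.1.apply i j
  have hdet := (hA.submatrix ![i, j]).det_nonneg
  simp only [Matrix.det_fin_two, Matrix.submatrix_apply, Matrix.of_apply, Matrix.cons_val_zero,
    Matrix.cons_val_one, hsymm] at hdet
  have hmem : contractionFactor A i * A i j * contractionFactor A j ∈ Set.Icc (-1 : ℝ) 1 := by
    rw [Set.mem_Icc, ← abs_le, ← sq_le_one_iff_abs_le_one]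
    have h1 : (contractionFactor A i * A i j * contractionFactor A j) ^ 2
        = (A i j * A i j) / ((1 + A i i) * (1 + A j j)) := by
      simp only [contractionFactor, mul_pow, inv_pow]
      rw [Real.sq_sqrt (by linarith), Real.sq_sqrt (by linarith)]
      field_simp
    rw [h1, div_le_one (by positivity)]
    nlinarith
  rw [contractMatrix, Set.projIcc_of_mem _ hmem]

theorem posSemidef_contractMatrix {A : ℕ → ℕ → ℝ} (hA : (Matrix.of A).PosSemidef) (n : ℕ) :
    (Matrix.of fun i j : Fin n => (contractMatrix A i j : ℝ)).PosSemidef := by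
  have h1 := (hA.submatrix (Fin.val : Fin n → ℕ)).conjTranspose_mul_mul_same
    (Matrix.diagonal fun i : Fin n => contractionFactor A i)
  convert h1 using 1
  ext i j
  simp [coe_contractMatrix hA, Matrix.diagonal_mul, Matrix.mul_diagonal]

/-- The contracted diagonal is `s = A i i / (1 + A i i)`, so `1 - s = (1 + A i i)⁻¹` recovers the
scale factor from the contracted matrix alone. -/
theorem expandMatrix_contractMatrix {A : ℕ → ℕ → ℝ} (hA : (Matrix.of A).PosSemidef) :
    expandMatrix (contractMatrix A) = A := by
  have hpos : ∀ i, 0 < 1 + A i i := fun i => by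
    have : 0 ≤ A i i := hA.diag_nonneg
    linarith
  have hc : ∀ i, 0 < contractionFactor A i := fun i => inv_pos.2 (Real.sqrt_pos.2 (hpos i))
  have hfac : ∀ i, expansionFactor (contractMatrix A i i) = (contractionFactor A i)⁻¹ := by
    intro i
    rw [expansionFactor, coe_contractMatrix hA]
    congr 1
    rw [Real.sqrt_eq_iff_mul_self_eq_of_pos (hc i)]
    have h1 : contractionFactor A i * contractionFactor A i = (1 + A i i)⁻¹ := by
      rw [contractionFactor, ← mul_inv, Real.mul_self_sqrt (hpos i).le]
    have h2 := (hpos i).ne'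
    calc contractionFactor A i * contractionFactor A i
        = 1 - A i i * (contractionFactor A i * contractionFactor A i) := by
          rw [h1]; field_simp; ring
      _ = _ := by ring
  funext i j
  have hi := (hc i).ne'
  have hj := (hc j).ne'
  rw [expandMatrix, hfac, hfac, coe_contractMatrix hA]
  field_simp

/-! ### Assembling the representation -/

/-- The vector of an index of an off-diagonal Gram array, after rescaling. -/
noncomputable def CoordArray.vector {H : Type*} [NormedAddCommGroup H] [InnerProductSpace ℝ H]
    (e : ℕ → H) (x : ℕ → SymmInterval) (s : SymmInterval) : H :=
  expansionFactor s • orthonormalSeries e x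

/-- The difference between the diagonal entry and the squared norm of the vector of an index of an
off-diagonal Gram array, after rescaling. -/
noncomputable def CoordArray.excess {H : Type*} [NormedAddCommGroup H] [InnerProductSpace ℝ H]
    (e : ℕ → H) (x : ℕ → SymmInterval) (s : SymmInterval) : ℝ≥0 :=
  Real.toNNReal (expansionFactor s ^ 2 * (s - ‖orthonormalSeries e x‖ ^ 2))

theorem CoordArray.IsOffDiagonalGram.gramPlusDiagonal_eq {H : Type*} [NormedAddCommGroup H]
    [InnerProductSpace ℝ H] [CompleteSpace H] {e : ℕ → H} (he : Orthonormal ℝ e) {z : CoordArray}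
    (hz : z.IsOffDiagonalGram) :
    gramPlusDiagonal (fun i => vector e (z.1 i) (z.2 i i)) (fun i => excess e (z.1 i) (z.2 i i)) =
      expandMatrix z.2 := by
  have hmem : ∀ i, z.1 i ∈ squareSumLeOne := fun i m => (hz.1 i m).trans (z.2 i i).2.2
  funext i j
  have hlim := he.tendsto_sum_inner_orthonormalSeries (hmem i) (hmem j)
  simp only [gramPlusDiagonal, vector, excess, expandMatrix, real_inner_smul_left,
    real_inner_smul_right]
  split_ifs with hij
  · subst hij
    rw [real_inner_self_eq_norm_sq] at hlim ⊢
    have h1 : ‖orthonormalSeries e (z.1 i)‖ ^ 2 ≤ z.2 i i :=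
      le_of_tendsto hlim (Filter.Eventually.of_forall fun m => by simpa [sq] using hz.1 i m)
    -- By `h1` the excess is nonnegative, so `Real.toNNReal` truncates nothing.
    rw [Real.coe_toNNReal _ (mul_nonneg (sq_nonneg _) (sub_nonneg.2 h1))]
    ring
  · rw [tendsto_nhds_unique hlim (hz.2 i j hij)]
    ring

/-- The representation holds over every separable Hilbert space that contains an orthonormal sequence. -/
theorem hasExchangeableGramRepresentation_of_orthonormal {Ω : Type*} [MeasurableSpace Ω]
    (P : Measure Ω) [IsProbabilityMeasure P] (R : Ω → ℕ → ℕ → ℝ) (hmeas : Measurable R)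
    (hpsd : ∀ᵐ ω ∂P, (Matrix.of (R ω)).PosSemidef) (hexch : IsJointlyExchangeable P R)
    {H : Type*} [NormedAddCommGroup H] [InnerProductSpace ℝ H] [CompleteSpace H]
    [SecondCountableTopology H] [MeasurableSpace H] [BorelSpace H] {e : ℕ → H}
    (he : Orthonormal ℝ e) :
    HasExchangeableGramRepresentation P R H := by
  classical
  -- Replacing `R` by zero on a measurable null set makes it positive semidefinite for every `ω`, as
  -- the choice of coordinates requires.
  obtain ⟨N, hN, hNm, hN0⟩ := exists_measurable_superset_of_null (ae_iff.1 hpsd)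
  let R₀ : Ω → ℕ → ℕ → ℝ := fun ω => if ω ∈ N then 0 else R ω
  have hR₀ : Measurable R₀ := Measurable.ite hNm measurable_const hmeas
  have hpsd₀ : ∀ ω, (Matrix.of (R₀ ω)).PosSemidef := by
    intro ω
    by_cases h : ω ∈ N
    · simp only [R₀, h, if_true]
      exact Matrix.PosSemidef.zero
    · simp only [R₀, h, if_false]
      by_contra h'
      exact h (hN h')
  have hae : R =ᵐ[P] R₀ := by
    filter_upwards [measure_eq_zero_iff_ae_notMem.1 hN0] with ω hω
    simp [R₀, hω]
  have hexch₀ : IsJointlyExchangeable P R₀ := by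
    intro σ hσ
    have h1 : (fun ω i j => R₀ ω (σ i) (σ j)) =ᵐ[P] fun ω i j => R ω (σ i) (σ j) := by
      filter_upwards [hae] with ω hω
      rw [hω]
    refine (IdentDistrib.of_ae_eq (Measurable.aemeasurable ?_) h1).trans
      ((hexch σ hσ).trans (IdentDistrib.of_ae_eq hmeas.aemeasurable hae))
    fun_prop
  obtain ⟨μ, hμ, hsnd, hinv, hgram⟩ := CoordArray.exists_exchangeable_law P
    (fun ω => contractMatrix (R₀ ω)) (measurable_contractMatrix.comp hR₀)
    (fun ω n => posSemidef_contractMatrix (hpsd₀ ω) n)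
    (fun σ hσ => (hexch₀ σ hσ).comp measurable_contractMatrix)
  have hF := he.measurable_orthonormalSeries
  have hX := measurable_expansionFactor
  have hvec : Measurable fun p : (ℕ → SymmInterval) × SymmInterval =>
      (CoordArray.vector e p.1 p.2, CoordArray.excess e p.1 p.2) := by
    simp only [CoordArray.vector, CoordArray.excess]
    fun_prop
  have hpair : ∀ i, Measurable fun z : CoordArray =>
      (CoordArray.vector e (z.1 i) (z.2 i i), CoordArray.excess e (z.1 i) (z.2 i i)) := fun i =>
    hvec.comp (g := _) (f := fun z : CoordArray => (z.1 i, z.2 i i)) (by fun_prop)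
  refine ⟨CoordArray, inferInstance, μ, hμ, fun i z => CoordArray.vector e (z.1 i) (z.2 i i),
    fun i z => CoordArray.excess e (z.1 i) (z.2 i i), fun i => (hpair i).fst,
    fun i => (hpair i).snd, fun σ hσ => ?_, ?_⟩
  · have h1 : IdentDistrib (CoordArray.relabel σ) id μ μ :=
      ⟨(CoordArray.continuous_relabel σ).measurable.aemeasurable, aemeasurable_id, by
        rw [hinv σ hσ, Measure.map_id]⟩
    -- The `i`-th pair is one fixed function of `z.1 i` and `z.2 i i`, so relabelling `z` permutes
    -- the pairs.
    exact h1.comp (measurable_pi_lambda _ hpair)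
  · have h1 : IdentDistrib (fun ω => contractMatrix (R₀ ω)) Prod.snd P μ :=
      ⟨(measurable_contractMatrix.comp hR₀).aemeasurable, measurable_snd.aemeasurable, hsnd.symm⟩
    have h2 : IdentDistrib R₀ (fun z => expandMatrix z.2) P μ := by
      have := h1.comp measurable_expandMatrix
      have h3 : expandMatrix ∘ (fun ω => contractMatrix (R₀ ω)) = R₀ :=
        funext fun ω => expandMatrix_contractMatrix (hpsd₀ ω)
      rwa [h3] at this
    refine (IdentDistrib.of_ae_eq hmeas.aemeasurable hae).trans (h2.trans
      (IdentDistrib.of_ae_eq (measurable_expandMatrix.comp measurable_snd).aemeasurable ?_))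
    filter_upwards [hgram] with z hz
    exact (hz.gramPlusDiagonal_eq he).symm

/-- The representation holds over some separable real Hilbert space, and more precisely over
`L²[0,1)`. -/
theorem mainTheorem3 {Ω : Type*} [MeasurableSpace Ω] (P : Measure Ω) [IsProbabilityMeasure P]
    (R : Ω → ℕ → ℕ → ℝ) (hmeas : Measurable R)
    (hpsd : ∀ᵐ ω ∂P, (Matrix.of (R ω)).PosSemidef)
    (hexch : IsJointlyExchangeable P R) :
    (∃ (H : Type) (_ : NormedAddCommGroup H) (_ : InnerProductSpace ℝ H)
      (_ : CompleteSpace H) (_ : TopologicalSpace.SeparableSpace H)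
      (_ : MeasurableSpace H) (_ : BorelSpace H),
      HasExchangeableGramRepresentation P R H) ∧
    HasExchangeableGramRepresentation P R L2UnitInterval := by
  obtain ⟨e, he⟩ := L2UnitInterval.exists_orthonormal
  have : Fact ((2 : ENNReal) ≠ ⊤) := ⟨by simp⟩
  have h := hasExchangeableGramRepresentation_of_orthonormal P R hmeas hpsd hexch he
  exact ⟨⟨L2UnitInterval, inferInstance, inferInstance, inferInstance, inferInstance, inferInstance,
    inferInstance, h⟩, h⟩
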